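/- There is a constant $C\in\mathbb N$ such that for every $k\in\mathbb N$ there is a single-commodity network consisting of a finite directed multigraph $(V,E)$ with $|V|\le C(k+1)$ and $|E|\le C(k+1)$, a source $s\in V$, a sink $t\in V$, a rational demand $d>0$, and affine edge cost functions $c_e^\lambda(y)=a_e y+b_e+g_e\lambda$ with rational constants $a_e>0$, $b_e\ge 0$, $g_e\ge 0$, for which the following holds. A feasible flow assigns a flow value $f_p\ge 0$ to each simple directed $s$-$t$-path $p$ such that $\sum_p f_p=d$; its edge loads are $x_e=\sum_{p\ni e}f_p$. It is a Wardrop equilibrium at price $\lambda$ if $f_p>0$ implies $\sum_{e\in p}c_e^\lambda(x_e)\le\sum_{e\in q}c_e^\lambda(x_e)$ for all simple $s$-$t$-paths $q$. For every $\lambda>0$ a Wardrop equilibrium exists and all Wardrop equilibria at price $\lambda$ have the same vector of edge loads $x(\lambda)\in\mathbb R^E$, and the map $\lambda\mapsto x(\lambda)$ on $(0,\infty)$ has at least $2^{k+1}$ breakpoints. Here a breakpoint is a $\lambda_0>0$ such that, for some $\varepsilon>0$, the map is affine on $[\lambda_0-\varepsilon,\lambda_0]$ and on $[\lambda_0,\lambda_0+\varepsilon]$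 with different slopes. -/

import Mathlib

/-- A single-commodity network: a finite directed multigraph with vertex type `V` and edge type `E`,
a source, a sink, a positive demand, and for every edge `e` the affine cost function
`y ↦ a e * y + b e + g e * price`, strictly increasing in the load `y`, with rational
coefficients `a e > 0`, `b e ≥ 0`, `g e ≥ 0`. -/
structure AffineNetwork (V E : Type) where
  /-- The tail of an edge. -/
  tail : E → V
  /-- The head of an edge. -/
  head : E → V
  /-- The source of the commodity. -/
  source : V
  /-- The sink of the commodity. -/
  sink : V
  /-- The demand of the commodity. -/
  demand : ℚ
  /-- The slope of the travel time of an edge. -/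
  a : E → ℚ
  /-- The offset of the travel time of an edge. -/
  b : E → ℚ
  /-- The externality factor of an edge. -/
  g : E → ℚ
  demand_pos : 0 < demand
  a_pos : ∀ e, 0 < a e
  b_nonneg : ∀ e, 0 ≤ b e
  g_nonneg : ∀ e, 0 ≤ g e

namespace AffineNetwork

/-- `N.IsWalk u p w`: the list of edges `p` is a directed walk from `u` to `w`. -/
def IsWalk {V E : Type} (N : AffineNetwork V E) : V → List E → V → Prop
  | u, [], w => u = w
  | u, e :: p, w => N.tail e = u ∧ N.IsWalk (N.head e) p w

/-- A simple path from source to sink: a directed walk that visits no vertex twice. -/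
def IsSimplePath {V E : Type} (N : AffineNetwork V E) (p : List E) : Prop :=
  N.IsWalk N.source p N.sink ∧ (N.source :: p.map N.head).Nodup

/-- The type of simple paths from source to sink. -/
def SimplePath {V E : Type} (N : AffineNetwork V E) : Type :=
  {p : List E // N.IsSimplePath p}

theorem finite_simplePath {V E : Type} [Fintype V] [Fintype E] (N : AffineNetwork V E) :
    Finite N.SimplePath := by
  refine Set.Finite.to_subtype ((List.finite_length_le E (Fintype.card V)).subset ?_)
  intro p hp
  have h := hp.2.length_le_card
  simp only [List.length_cons, List.length_map] at h
  exact (Nat.le_succ _).trans h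

noncomputable instance instFintypeSimplePath {V E : Type} [Fintype V] [Fintype E]
    (N : AffineNetwork V E) : Fintype N.SimplePath :=
  @Fintype.ofFinite _ N.finite_simplePath

/-- A feasible flow: nonnegative path flows that sum up to the demand. -/
def IsFeasible {V E : Type} [Fintype V] [Fintype E] (N : AffineNetwork V E)
    (f : N.SimplePath → ℝ) : Prop :=
  (∀ p, 0 ≤ f p) ∧ ∑ p, f p = (N.demand : ℝ)

open Classical in
/-- The load of an edge: the total flow on the paths that use it. -/
noncomputable def load {V E : Type} [Fintype V] [Fintype E] (N : AffineNetwork V E)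
    (f : N.SimplePath → ℝ) (e : E) : ℝ :=
  ∑ p : N.SimplePath, if e ∈ p.1 then f p else 0

/-- The cost of edge `e` at price `price` when its load is `y`. -/
noncomputable def edgeCost {V E : Type} (N : AffineNetwork V E) (price : ℝ) (e : E) (y : ℝ) : ℝ :=
  (N.a e : ℝ) * y + (N.b e : ℝ) + (N.g e : ℝ) * price

/-- The cost of a path under a flow: the sum of the costs of its edges at the current loads. -/
noncomputable def pathCost {V E : Type} [Fintype V] [Fintype E] (N : AffineNetwork V E)
    (price : ℝ) (f : N.SimplePath → ℝ) (p : N.SimplePath) : ℝ :=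
  (p.1.map fun e => N.edgeCost price e (N.load f e)).sum

/-- A Wardrop equilibrium at price `price`: a feasible flow that uses only cheapest paths. -/
def IsWardrop {V E : Type} [Fintype V] [Fintype E] (N : AffineNetwork V E)
    (price : ℝ) (f : N.SimplePath → ℝ) : Prop :=
  N.IsFeasible f ∧ ∀ p, 0 < f p → ∀ q, N.pathCost price f p ≤ N.pathCost price f q

/-- The Wardrop equilibria at price `price`, written as edge flows. -/
def IsWardropEdgeFlow {V E : Type} [Fintype V] [Fintype E] (N : AffineNetwork V E)
    (price : ℝ) (y : E → ℝ) : Prop :=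
  ∃ f : N.SimplePath → ℝ, N.IsWardrop price f ∧ N.load f = y

end AffineNetwork

/-- `t` is a breakpoint of `x`: `x` is affine on a small interval `[t - ε, t]` and on a small
interval `[t, t + ε]`, with different slopes. -/
def IsBreakpoint {E : Type} (x : ℝ → E → ℝ) (t : ℝ) : Prop :=
  ∃ ε : ℝ, 0 < ε ∧ ∃ m₁ m₂ : E → ℝ, m₁ ≠ m₂ ∧
    ∀ h : ℝ, 0 ≤ h → h ≤ ε → x (t - h) = x t - h • m₁ ∧ x (t + h) = x t + h • m₂

/-! A Braess network folds the equilibrium curve of the network that takes the place of its bridge.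
As the demand grows, the whole flow first crosses the bridge, and the bridge runs through its curve;
once the two arcs that skip one half of the bridge route become tight, more demand means less flow
on the bridge, and the bridge runs through its curve backwards. Nesting therefore doubles the number
of linear pieces and adds only two vertices and four edges, and the flow on the innermost edge
oscillates between `0` and `1`, so that the slope changes sign at every knot.

An additional edge from the source to the sink whose cost contains the price sheds demand onto the
nested network as the price rises. Equilibria for one set of tight edges are closed under convex
combinations of prices and states, so between two knots the equilibrium is the linear interpolation;
edge loads are unique because the costs are strictly increasing. -/

open scoped NNReal

/-- The map `x` is affine on the interval `[a, b]`, on which its coordinate `c` changes from one of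
the values `0` and `1` to the other. -/
structure IsSwing {ι : Type} (x : ℝ → ι → ℝ) (c : ι) (a b : ℝ) : Prop where
  lt : a < b
  eq_add_smul_slope : ∀ t ∈ Set.Icc a b, x t = x a + (t - a) • slope x a b
  apply_eq : x a c = 0 ∧ x b c = 1 ∨ x a c = 1 ∧ x b c = 0

theorem IsSwing.isBreakpoint {ι : Type} {x : ℝ → ι → ℝ} {c : ι} {t₀ t₁ t₂ : ℝ}
    (h₀ : IsSwing x c t₀ t₁) (h₁ : IsSwing x c t₁ t₂) : IsBreakpoint x t₁ := by
  have hpos₀ := inv_pos.2 (sub_pos.2 h₀.lt)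
  have hpos₁ := inv_pos.2 (sub_pos.2 h₁.lt)
  refine ⟨min (t₁ - t₀) (t₂ - t₁), lt_min (sub_pos.2 h₀.lt) (sub_pos.2 h₁.lt), slope x t₀ t₁,
    slope x t₁ t₂, fun hslope => ?_, fun h hh hε => ⟨?_, ?_⟩⟩
  · have hc := congrFun hslope c
    simp only [slope_def_module, Pi.smul_apply, Pi.sub_apply, smul_eq_mul] at hc
    rcases h₀.apply_eq with ⟨hx₀, hx₁⟩ | ⟨hx₀, hx₁⟩ <;>
      rcases h₁.apply_eq with ⟨hx₁', hx₂⟩ | ⟨hx₁', hx₂⟩ <;>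
      rw [hx₀, hx₁, hx₂] at hc <;> linarith
  · have hleft := hε.trans (min_le_left _ _)
    rw [h₀.eq_add_smul_slope (t₁ - h) ⟨by linarith, by linarith⟩,
      h₀.eq_add_smul_slope t₁ ⟨h₀.lt.le, le_rfl⟩]
    module
  · have hright := hε.trans (min_le_right _ _)
    rw [h₁.eq_add_smul_slope (t₁ + h) ⟨by linarith, by linarith⟩, add_sub_cancel_left]

namespace AffineNetwork

variable {V E V' E' : Type} {N : AffineNetwork V E} {N' : AffineNetwork V' E'}

theorem IsWalk.append {p q : List E} {u v w : V} (hp : N.IsWalk u p v) (hq : N.IsWalk v q w) :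
    N.IsWalk u (p ++ q) w := by
  induction p generalizing u with
  | nil => cases hp; exact hq
  | cons e p ih => exact ⟨hp.1, ih hp.2⟩

theorem IsWalk.map {φ : V → V'} {ψ : E → E'} (htail : ∀ e, N'.tail (ψ e) = φ (N.tail e))
    (hhead : ∀ e, N'.head (ψ e) = φ (N.head e)) {p : List E} {u w : V} (hp : N.IsWalk u p w) :
    N'.IsWalk (φ u) (p.map ψ) (φ w) := by
  induction p generalizing u with
  | nil => exact congrArg φ hp
  | cons e p ih => exact ⟨(htail e).trans (congrArg φ hp.1), (hhead e).symm ▸ ih hp.2⟩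

theorem IsWalk.sub_eq_sum {π : V → ℝ} {p : List E} {u w : V} (hp : N.IsWalk u p w) :
    π w - π u = (p.map fun e => π (N.head e) - π (N.tail e)).sum := by
  induction p generalizing u with
  | nil => cases hp; simp
  | cons e p ih =>
    rw [List.map_cons, List.sum_cons, ← ih hp.2, hp.1]
    ring

section Wardrop

theorem SimplePath.nodup (p : N.SimplePath) : p.1.Nodup :=
  (List.nodup_cons.1 p.2.2).2.of_map _

variable [Fintype V] [Fintype E] {price : ℝ}

theorem le_load {f : N.SimplePath → ℝ} (hf : ∀ p, 0 ≤ f p) {p : N.SimplePath} {e : E}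
    (he : e ∈ p.1) : f p ≤ N.load f e := by
  classical
  calc f p = if e ∈ p.1 then f p else 0 := (if_pos he).symm
    _ ≤ N.load f e := Finset.single_le_sum (f := fun q : N.SimplePath => if e ∈ q.1 then f q else 0)
      (fun q _ => by split_ifs; exacts [hf q, le_rfl]) (Finset.mem_univ p)

theorem sum_mul_sum_map_eq_sum_load_mul (f : N.SimplePath → ℝ) (c : E → ℝ) :
    ∑ p, f p * (p.1.map c).sum = ∑ e, N.load f e * c e := by
  classical
  have hpath (p : N.SimplePath) : (p.1.map c).sum = ∑ e, if e ∈ p.1 then c e else 0 := by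
    rw [← List.sum_toFinset c p.nodup, ← Finset.sum_filter]
    congr 1
    ext e
    simp
  simp only [hpath, load, Finset.mul_sum, Finset.sum_mul]
  rw [Finset.sum_comm]
  simp only [mul_ite, ite_mul, mul_zero, zero_mul]

theorem IsWardrop.sum_load_mul_edgeCost_le {f f' : N.SimplePath → ℝ} (hf : N.IsWardrop price f)
    (hf' : N.IsFeasible f') :
    ∑ e, N.load f e * N.edgeCost price e (N.load f e) ≤
      ∑ e, N.load f' e * N.edgeCost price e (N.load f e) := by
  obtain ⟨p₀, -, hp₀⟩ : ∃ p ∈ Finset.univ, 0 < f p := by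
    apply Finset.exists_lt_of_sum_lt
    simpa [hf.1.2] using N.demand_pos
  have hused (p) : f p * N.pathCost price f p = f p * N.pathCost price f p₀ := by
    rcases (hf.1.1 p).eq_or_lt with hp | hp
    · simp [← hp]
    · rw [(hf.2 p hp p₀).antisymm (hf.2 p₀ hp₀ p)]
  rw [← sum_mul_sum_map_eq_sum_load_mul, ← sum_mul_sum_map_eq_sum_load_mul]
  calc ∑ p, f p * N.pathCost price f p = N.demand * N.pathCost price f p₀ := by
        rw [Finset.sum_congr rfl fun p _ => hused p, ← Finset.sum_mul, hf.1.2]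
    _ = ∑ p, f' p * N.pathCost price f p₀ := by rw [← Finset.sum_mul, hf'.2]
    _ ≤ ∑ p, f' p * N.pathCost price f p :=
        Finset.sum_le_sum fun p _ => mul_le_mul_of_nonneg_left (hf.2 p₀ hp₀ p) (hf'.1 p)

theorem IsWardropEdgeFlow.unique {y y' : E → ℝ} (hy : N.IsWardropEdgeFlow price y)
    (hy' : N.IsWardropEdgeFlow price y') : y = y' := by
  obtain ⟨f, hf, rfl⟩ := hy
  obtain ⟨f', hf', rfl⟩ := hy'
  have ha (e) : (0 : ℝ) < N.a e := by exact_mod_cast N.a_pos e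
  have hterm (e) : 0 ≤ (N.a e : ℝ) * (N.load f e - N.load f' e) ^ 2 :=
    mul_nonneg (ha e).le (sq_nonneg _)
  have hsum : ∑ e, (N.a e : ℝ) * (N.load f e - N.load f' e) ^ 2 =
      (∑ e, N.load f e * N.edgeCost price e (N.load f e) -
        ∑ e, N.load f' e * N.edgeCost price e (N.load f e)) +
      (∑ e, N.load f' e * N.edgeCost price e (N.load f' e) -
        ∑ e, N.load f e * N.edgeCost price e (N.load f' e)) := by
    simp only [← Finset.sum_sub_distrib, ← Finset.sum_add_distrib, edgeCost]
    exact Finset.sum_congr rfl fun e _ => by ring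
  have hzero : ∑ e, (N.a e : ℝ) * (N.load f e - N.load f' e) ^ 2 = 0 := by
    refine le_antisymm ?_ (Finset.sum_nonneg fun e _ => hterm e)
    linarith [hf.sum_load_mul_edgeCost_le hf'.1, hf'.sum_load_mul_edgeCost_le hf.1]
  funext e
  have he := (Finset.sum_eq_zero_iff_of_nonneg fun e _ => hterm e).1 hzero e (Finset.mem_univ e)
  simpa [(ha e).ne', sub_eq_zero] using he

end Wardrop

section FlowCone

/-- The unit flow along a path, as the pair of its value and its edge loads. -/
noncomputable def pathVector (p : N.SimplePath) : ℝ × (E → ℝ) :=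
  (1, Set.indicator {e | e ∈ p.1} 1)

/-- The convex cone of the pairs `(u, y)` such that `y` is the vector of edge loads of a
nonnegative path flow of value `u`. -/
noncomputable def flowCone (N : AffineNetwork V E) : Submodule ℝ≥0 (ℝ × (E → ℝ)) :=
  Submodule.span ℝ≥0 (Set.range fun p : N.SimplePath => pathVector p)

theorem pathVector_mem_flowCone (p : N.SimplePath) : pathVector p ∈ N.flowCone :=
  Submodule.subset_span ⟨p, rfl⟩

theorem map_mem_flowCone {L : ℝ × (E → ℝ) →ₗ[ℝ≥0] ℝ × (E' → ℝ)}
    (hL : ∀ p : N.SimplePath, L (pathVector p) ∈ N'.flowCone) {x : ℝ × (E → ℝ)}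
    (hx : x ∈ N.flowCone) : L x ∈ N'.flowCone :=
  Submodule.span_le (p := N'.flowCone.comap L).2 (Set.range_subset_iff.2 hL) hx

theorem smul_mem_flowCone {a : ℝ} (ha : 0 ≤ a) {x : ℝ × (E → ℝ)} (hx : x ∈ N.flowCone) :
    a • x ∈ N.flowCone :=
  N.flowCone.smul_mem ⟨a, ha⟩ hx

theorem exists_pathFlow_of_mem_flowCone [Fintype V] [Fintype E] {u : ℝ} {y : E → ℝ}
    (h : (u, y) ∈ N.flowCone) :
    ∃ f : N.SimplePath → ℝ, (∀ p, 0 ≤ f p) ∧ ∑ p, f p = u ∧ N.load f = y := by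
  classical
  obtain ⟨f, hf⟩ := (Submodule.mem_span_range_iff_exists_fun ℝ≥0).1 h
  refine ⟨fun p => f p, fun p => (f p).2, ?_, ?_⟩
  · simpa [pathVector, Prod.fst_sum, NNReal.smul_def] using congrArg Prod.fst hf
  · funext e
    simpa [pathVector, load, Prod.snd_sum, NNReal.smul_def, Set.indicator_apply]
      using congrFun (congrArg Prod.snd hf) e

end FlowCone

section Equilibrium

/-- A candidate equilibrium for a variable demand: the demand `value`, the common cost `cost` of
the used paths, and the edge loads `flow`. -/
structure FlowState (E : Type) where
  /-- The demand. -/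
  value : ℝ
  /-- The cost of a cheapest path. -/
  cost : ℝ
  /-- The edge loads. -/
  flow : E → ℝ

/-- The state `s` is an equilibrium at the given price, certified by vertex potentials for which
all edges in `T` are tight, and uses edges in `T` only. For a fixed set `T`, these conditions are
convex in the price and the state. -/
structure IsEquilibriumOn (N : AffineNetwork V E) (T : Set E) (price : ℝ) (s : FlowState E) :
    Prop where
  mem_flowCone : (s.value, s.flow) ∈ N.flowCone
  flow_eq_zero : ∀ e ∉ T, s.flow e = 0
  exists_potential : ∃ π : V → ℝ, π N.sink - π N.source = s.cost ∧
    (∀ e, π (N.head e) - π (N.tail e) ≤ N.edgeCost price e (s.flow e)) ∧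
    ∀ e ∈ T, π (N.head e) - π (N.tail e) = N.edgeCost price e (s.flow e)

theorem IsEquilibriumOn.isWardropEdgeFlow [Fintype V] [Fintype E] {T : Set E} {price : ℝ}
    {s : FlowState E} (hs : N.IsEquilibriumOn T price s) (hd : s.value = N.demand) :
    N.IsWardropEdgeFlow price s.flow := by
  obtain ⟨f, hf, hsum, hload⟩ := exists_pathFlow_of_mem_flowCone hs.mem_flowCone
  obtain ⟨π, hπ, hle, heq⟩ := hs.exists_potential
  have hcost (p : N.SimplePath) : s.cost ≤ N.pathCost price f p := by
    rw [← hπ, p.2.1.sub_eq_sum, pathCost, hload]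
    exact List.sum_le_sum fun e _ => hle e
  have hcost_used (p : N.SimplePath) (hp : 0 < f p) : N.pathCost price f p = s.cost := by
    rw [← hπ, p.2.1.sub_eq_sum, pathCost, hload]
    congr 1
    refine List.map_congr_left fun e he => (heq e ?_).symm
    by_contra heT
    have hpos := hp.trans_le (le_load hf he)
    rw [hload, hs.flow_eq_zero e heT] at hpos
    exact hpos.false
  exact ⟨f, ⟨⟨hf, hsum.trans hd⟩, fun p hp q => (hcost_used p hp).trans_le (hcost q)⟩, hload⟩

theorem IsEquilibriumOn.convexComb {T : Set E} {t t' : ℝ} {s s' : FlowState E}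
    (hs : N.IsEquilibriumOn T t s) (hs' : N.IsEquilibriumOn T t' s') {a b : ℝ} (ha : 0 ≤ a)
    (hb : 0 ≤ b) (hab : a + b = 1) :
    N.IsEquilibriumOn T (a * t + b * t')
      ⟨a * s.value + b * s'.value, a * s.cost + b * s'.cost, a • s.flow + b • s'.flow⟩ where
  mem_flowCone := N.flowCone.add_mem (smul_mem_flowCone ha hs.mem_flowCone)
    (smul_mem_flowCone hb hs'.mem_flowCone)
  flow_eq_zero e he := by simp [hs.flow_eq_zero e he, hs'.flow_eq_zero e he]
  exists_potential := by
    obtain ⟨π, hπ, hle, heq⟩ := hs.exists_potential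
    obtain ⟨π', hπ', hle', heq'⟩ := hs'.exists_potential
    have hdiff (v w) : (a • π + b • π') v - (a • π + b • π') w =
        a * (π v - π w) + b * (π' v - π' w) := by
      simp only [Pi.add_apply, Pi.smul_apply, smul_eq_mul]
      ring
    have hedge (e) : N.edgeCost (a * t + b * t') e ((a • s.flow + b • s'.flow) e) =
        a * N.edgeCost t e (s.flow e) + b * N.edgeCost t' e (s'.flow e) := by
      simp only [edgeCost, Pi.add_apply, Pi.smul_apply, smul_eq_mul]
      linear_combination -(N.b e : ℝ) * hab
    refine ⟨a • π + b • π', by rw [hdiff, hπ, hπ'], fun e => ?_, fun e he => ?_⟩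
    · rw [hdiff, hedge]
      gcongr
      exacts [hle e, hle' e]
    · rw [hdiff, hedge, heq e he, heq' e he]

theorem IsEquilibriumOn.isWardropEdgeFlow_of_mem_Icc [Fintype V] [Fintype E] {T : Set E}
    {t₀ t₁ t : ℝ} {s₀ s₁ : FlowState E} (hs₀ : N.IsEquilibriumOn T t₀ s₀)
    (hs₁ : N.IsEquilibriumOn T t₁ s₁) (hd₀ : s₀.value = N.demand) (hd₁ : s₁.value = N.demand)
    (hlt : t₀ < t₁) (ht : t ∈ Set.Icc t₀ t₁) :
    N.IsWardropEdgeFlow t (s₀.flow + (t - t₀) • (t₁ - t₀)⁻¹ • (s₁.flow - s₀.flow)) := by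
  have hpos := sub_pos.2 hlt
  set θ := (t - t₀) / (t₁ - t₀) with hθ
  have hθ₀ : 0 ≤ θ := div_nonneg (sub_nonneg.2 ht.1) hpos.le
  have hθ₁ : θ ≤ 1 := (div_le_one hpos).2 (by linarith [ht.2])
  have hprice : (1 - θ) * t₀ + θ * t₁ = t := by
    linear_combination div_mul_cancel₀ (t - t₀) hpos.ne'
  have hflow : s₀.flow + (t - t₀) • (t₁ - t₀)⁻¹ • (s₁.flow - s₀.flow) =
      (1 - θ) • s₀.flow + θ • s₁.flow := by
    rw [smul_smul, ← div_eq_mul_inv, ← hθ]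
    module
  rw [hflow, ← hprice]
  refine (hs₀.convexComb hs₁ (sub_nonneg.2 hθ₁) hθ₀ (by ring)).isWardropEdgeFlow ?_
  rw [hd₀, hd₁]
  ring

end Equilibrium

section Braess

/-- The four arcs that surround the bridge in a Braess network. The arcs `enter` and `leave` lead
from the source to the bridge and from the bridge to the sink; `skipFirst` leads from the source to
the end of the bridge and `skipLast` from the beginning of the bridge to the sink. -/
inductive BraessArc
  | enter
  | leave
  | skipFirst
  | skipLast

open BraessArc

instance : Fintype BraessArc :=
  ⟨⟨{enter, leave, skipFirst, skipLast}, by simp⟩, by rintro (_ | _) <;> simp⟩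

/-- The Braess network whose bridge is the network `N`, with the source `Sum.inr false` and the
sink `Sum.inr true`. The coefficients are chosen so that, as the demand rises to `8 * N.demand`,
the flow on the bridge first rises to `N.demand` and then falls back to zero. -/
def braess (N : AffineNetwork V E) : AffineNetwork (V ⊕ Bool) (E ⊕ BraessArc) where
  tail
    | .inl e => .inl (N.tail e)
    | .inr enter => .inr false
    | .inr leave => .inl N.sink
    | .inr skipFirst => .inr false
    | .inr skipLast => .inl N.source
  head
    | .inl e => .inl (N.head e)
    | .inr enter => .inl N.source
    | .inr leave => .inr true
    | .inr skipFirst => .inl N.sink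
    | .inr skipLast => .inr true
  source := .inr false
  sink := .inr true
  demand := 8 * N.demand
  a
    | .inl e => N.a e
    | .inr enter | .inr leave => 2
    | .inr skipFirst | .inr skipLast => 1
  b
    | .inl e => N.b e
    | .inr enter | .inr leave => 0
    | .inr skipFirst | .inr skipLast => 4 * N.demand
  g := Sum.elim N.g 0
  demand_pos := mul_pos (by norm_num) N.demand_pos
  a_pos := by rintro (e | _ | _) <;> simp [N.a_pos]
  b_nonneg := by rintro (e | _ | _) <;> simp [N.b_nonneg, N.demand_pos.le]
  g_nonneg := by rintro (e | _) <;> simp [N.g_nonneg]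

theorem IsSimplePath.braess {p : List E} (hp : N.IsSimplePath p) :
    N.braess.IsSimplePath (.inr enter :: (p.map .inl ++ [.inr leave])) := by
  have hbridge : N.braess.IsWalk (.inl N.source) (p.map .inl) (.inl N.sink) :=
    hp.1.map (φ := Sum.inl) (ψ := Sum.inl) (fun _ => rfl) fun _ => rfl
  have hleave : N.braess.IsWalk (.inl N.sink) [.inr leave] (.inr true) := ⟨rfl, rfl⟩
  refine ⟨⟨rfl, hbridge.append hleave⟩, ?_⟩
  have hinl : ((N.source :: p.map N.head).map (Sum.inl : V → V ⊕ Bool)).Nodup :=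
    hp.2.map Sum.inl_injective
  have hnodup : (Sum.inr false ::
      ((N.source :: p.map N.head).map Sum.inl ++ [Sum.inr true])).Nodup := by
    simpa [List.nodup_append] using hinl
  simp only [List.map_cons, List.map_append, List.map_map] at hnodup ⊢
  exact hnodup

/-- The path in `N.braess` that crosses the bridge along the path `p`. -/
def SimplePath.braess (p : N.SimplePath) : N.braess.SimplePath :=
  ⟨_, p.2.braess⟩

/-- The path in `N.braess` along `skipFirst`. -/
def skipFirstPath (N : AffineNetwork V E) : N.braess.SimplePath :=
  ⟨[.inr skipFirst, .inr leave], by simp [IsSimplePath, IsWalk, braess]⟩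

/-- The path in `N.braess` along `skipLast`. -/
def skipLastPath (N : AffineNetwork V E) : N.braess.SimplePath :=
  ⟨[.inr enter, .inr skipLast], by simp [IsSimplePath, IsWalk, braess]⟩

/-- The edge loads in a Braess network when `w` units are sent in total and the flow `y` of value
`u` crosses the bridge. -/
noncomputable def braessFlow (w u : ℝ) (y : E → ℝ) : E ⊕ BraessArc → ℝ
  | .inl e => y e
  | .inr enter | .inr leave => (w + u) / 2
  | .inr skipFirst | .inr skipLast => (w - u) / 2

theorem bridge_mem_flowCone_braess {u : ℝ} {y : E → ℝ} (h : (u, y) ∈ N.flowCone) :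
    (u, braessFlow u u y) ∈ N.braess.flowCone := by
  classical
  let L : ℝ × (E → ℝ) →ₗ[ℝ≥0] ℝ × (E ⊕ BraessArc → ℝ) :=
    { toFun := fun x => (x.1, braessFlow x.1 x.1 x.2)
      map_add' := fun x x' => by
        ext (_ | _ | _) <;> simp [braessFlow]
      map_smul' := fun a x => by
        ext (_ | _ | _) <;> simp [braessFlow, NNReal.smul_def] }
  refine map_mem_flowCone (L := L) (fun p => ?_) h
  convert! pathVector_mem_flowCone p.braess using 1
  ext (_ | _ | _) <;> simp [L, pathVector, braessFlow, SimplePath.braess, Set.indicator_apply]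

theorem mem_flowCone_braess {w u : ℝ} {y : E → ℝ} (h : (u, y) ∈ N.flowCone) (hw : u ≤ w) :
    (w, braessFlow w u y) ∈ N.braess.flowCone := by
  classical
  have hsplit : (w, braessFlow w u y) = (u, braessFlow u u y) +
      ((w - u) / 2) • (pathVector N.skipFirstPath + pathVector N.skipLastPath) := by
    ext (_ | _ | _) <;>
      simp [pathVector, braessFlow, skipFirstPath, skipLastPath]
    all_goals ring
  rw [hsplit]
  exact N.braess.flowCone.add_mem (bridge_mem_flowCone_braess h)
    (smul_mem_flowCone (by linarith) (N.braess.flowCone.add_mem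
      (pathVector_mem_flowCone _) (pathVector_mem_flowCone _)))

/-- The state of a Braess network of value `w` whose bridge is in the state `s`. -/
noncomputable def FlowState.braess (s : FlowState E) (w : ℝ) : FlowState (E ⊕ BraessArc) :=
  ⟨w, s.cost + 2 * (w + s.value), braessFlow w s.value s.flow⟩

theorem IsEquilibriumOn.braess {T : Set E} {price : ℝ} {s : FlowState E}
    (hs : N.IsEquilibriumOn T price s) {w : ℝ} (hw : s.value ≤ w)
    (hle : w ≤ 8 * N.demand - 2 * s.cost - 3 * s.value) {skip : Prop}
    (htight : skip → w = 8 * N.demand - 2 * s.cost - 3 * s.value) (hidle : ¬skip → w = s.value) :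
    N.braess.IsEquilibriumOn (Sum.inl '' T ∪ Sum.inr '' {i | i = enter ∨ i = leave ∨ skip}) price
      (s.braess w) where
  mem_flowCone := mem_flowCone_braess hs.mem_flowCone hw
  flow_eq_zero := by
    rintro (e | _ | _) he <;>
      simp only [Set.mem_union, Set.mem_image, Set.mem_ofPred_eq] at he <;>
      simp_all [FlowState.braess, braessFlow, hs.flow_eq_zero]
  exists_potential := by
    obtain ⟨π, hπ, hπ_le, hπ_eq⟩ := hs.exists_potential
    let π' : V ⊕ Bool → ℝ
      | .inl v => π v
      | .inr false => π N.source - (w + s.value)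
      | .inr true => π N.sink + (w + s.value)
    refine ⟨π', ?_, ?_, ?_⟩
    · simp only [AffineNetwork.braess, FlowState.braess, π']
      linarith
    · rintro (e | _ | _ | _ | _)
      · exact hπ_le e
      all_goals
        simp only [AffineNetwork.braess, FlowState.braess, edgeCost, braessFlow, Sum.elim_inr,
          Pi.zero_apply, π']
        push_cast
        linarith
    · rintro (e | i) he
      · exact hπ_eq e (by simpa using he)
      have hi : i = enter ∨ i = leave ∨ w = 8 * N.demand - 2 * s.cost - 3 * s.value := by
        have : i = enter ∨ i = leave ∨ skip := by simpa using he
        exact this.imp_right (Or.imp_right htight)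
      cases i <;>
        simp only [AffineNetwork.braess, FlowState.braess, edgeCost, braessFlow, Sum.elim_inr,
          Pi.zero_apply, π', reduceCtorEq, false_or, true_or, or_true] at hi ⊢ <;>
        push_cast <;> linarith

/-- The state of a Braess network whose bridge is in the state `s` and whose arcs `skipFirst` and
`skipLast` are idle. -/
noncomputable def FlowState.bridged (s : FlowState E) : FlowState (E ⊕ BraessArc) :=
  s.braess s.value

/-- The state of a Braess network whose bridge is in the state `s` and whose arcs `skipFirst` and
`skipLast` are tight, where `d` is the demand of the bridge. -/
noncomputable def FlowState.bypassed (d : ℝ) (s : FlowState E) : FlowState (E ⊕ BraessArc) :=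
  s.braess (8 * d - 2 * s.cost - 3 * s.value)

end Braess

section Curve

/-- The equilibria `s` and `s'` span a linear piece of the curve of equilibria with increasing
demand, along which the flow on the edge `c` changes from one of the values `0` and `1` to the
other. The cost rises by more than `1` because an additional edge that serves the whole demand costs
`1` more than the price: all knots except the first one then belong to positive prices. -/
structure IsStep (N : AffineNetwork V E) (c : E) (s s' : FlowState E) : Prop where
  value_nonneg : 0 ≤ s.value
  cost_nonneg : 0 ≤ s.cost
  value_lt : s.value < s'.value
  cost_add_one_lt : s.cost + 1 < s'.cost
  value_le : s'.value ≤ N.demand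
  cost_le : s'.cost ≤ 2 * N.demand
  flow_eq : s.flow c = 0 ∧ s'.flow c = 1 ∨ s.flow c = 1 ∧ s'.flow c = 0
  exists_isEquilibriumOn : ∃ T, ∀ price, N.IsEquilibriumOn T price s ∧ N.IsEquilibriumOn T price s'

variable {c : E} {s s' : FlowState E}

theorem IsStep.bridged (h : N.IsStep c s s') : N.braess.IsStep (.inl c) s.bridged s'.bridged := by
  obtain ⟨hu, hφ, hu', hφ', hd, hd', hflow, T, hT⟩ := h
  have hle : s.value ≤ 8 * N.demand - 2 * s.cost - 3 * s.value := by linarith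
  have hle' : s'.value ≤ 8 * N.demand - 2 * s'.cost - 3 * s'.value := by linarith
  refine ⟨?_, ?_, ?_, ?_, ?_, ?_, hflow, _, fun price =>
    ⟨(hT price).1.braess (skip := False) le_rfl hle False.elim fun _ => rfl,
      (hT price).2.braess le_rfl hle' False.elim fun _ => rfl⟩⟩
  all_goals
    simp only [FlowState.bridged, FlowState.braess, AffineNetwork.braess]
    push_cast
    linarith

theorem IsStep.bypassed (h : N.IsStep c s s') :
    N.braess.IsStep (.inl c) (s'.bypassed N.demand) (s.bypassed N.demand) := by
  obtain ⟨hu, hφ, hu', hφ', hd, hd', hflow, T, hT⟩ := h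
  have hle : s.value ≤ 8 * N.demand - 2 * s.cost - 3 * s.value := by linarith
  have hle' : s'.value ≤ 8 * N.demand - 2 * s'.cost - 3 * s'.value := by linarith
  refine ⟨?_, ?_, ?_, ?_, ?_, ?_, hflow.symm.imp And.symm And.symm, _, fun price =>
    ⟨(hT price).2.braess (skip := True) hle' le_rfl (fun _ => rfl) fun h => (h trivial).elim,
      (hT price).1.braess hle le_rfl (fun _ => rfl) fun h => (h trivial).elim⟩⟩
  all_goals
    simp only [FlowState.bypassed, FlowState.braess, AffineNetwork.braess]
    push_cast
    linarith

theorem FlowState.bypassed_eq_bridged {d : ℝ} (hvalue : s.value = d) (hcost : s.cost = 2 * d) :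
    s.bypassed d = s.bridged := by
  rw [FlowState.bypassed, FlowState.bridged, hvalue, hcost]
  congr 1
  ring

/-- The relation `IsStep` in the form that `RelSeries` requires. -/
def stepRel (N : AffineNetwork V E) (c : E) : SetRel (FlowState E) (FlowState E) :=
  {p | N.IsStep c p.1 p.2}

/-- The piecewise linear curve of the equilibria of `N`, as the demand rises from zero to
`N.demand`, given by the sequence of its knots. The flow on the edge `c` alternates between `0` and
`1` at the knots. -/
structure EquilibriumCurve (N : AffineNetwork V E) (c : E) extends RelSeries (N.stepRel c) where
  value_head : toRelSeries.head.value = 0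
  cost_head : toRelSeries.head.cost = 0
  value_last : toRelSeries.last.value = N.demand
  cost_last : toRelSeries.last.cost = 2 * N.demand

namespace EquilibriumCurve

/-- The knots of the curve of a Braess network. Crossing the bridge runs through the curve of `N`,
and bypassing it then runs through the same curve backwards. -/
noncomputable def braessSeries (p : N.EquilibriumCurve c) :
    RelSeries (N.braess.stepRel (.inl c)) :=
  (p.map (⟨FlowState.bridged, IsStep.bridged⟩ :
    (N.stepRel c).Hom (N.braess.stepRel (.inl c)))).smash
  (p.reverse.map (⟨FlowState.bypassed N.demand, IsStep.bypassed⟩ :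
    (N.stepRel c).inv.Hom (N.braess.stepRel (.inl c))))
  (by
    rw [RelSeries.last_map, RelSeries.head_map, RelSeries.head_reverse]
    exact (FlowState.bypassed_eq_bridged p.value_last p.cost_last).symm)

theorem head_braessSeries (p : N.EquilibriumCurve c) :
    p.braessSeries.head = p.head.bridged := by
  rw [braessSeries, RelSeries.head_smash, RelSeries.head_map]
  rfl

theorem last_braessSeries (p : N.EquilibriumCurve c) :
    p.braessSeries.last = p.head.bypassed N.demand := by
  rw [braessSeries, RelSeries.last_smash, RelSeries.last_map, RelSeries.last_reverse]
  rfl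

/-- The curve of the Braess network whose bridge is `N`. -/
noncomputable def braess (p : N.EquilibriumCurve c) : N.braess.EquilibriumCurve (.inl c) where
  toRelSeries := p.braessSeries
  value_head := by
    rw [head_braessSeries]
    exact p.value_head
  cost_head := by
    simp [head_braessSeries, FlowState.bridged, FlowState.braess, p.value_head, p.cost_head]
  value_last := by
    rw [last_braessSeries]
    simp [FlowState.bypassed, FlowState.braess, AffineNetwork.braess, p.value_head, p.cost_head]
  cost_last := by
    rw [last_braessSeries]
    simp [FlowState.bypassed, FlowState.braess, AffineNetwork.braess, p.value_head, p.cost_head]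

end EquilibriumCurve

/-- The network that consists of a single edge. -/
def singleEdge : AffineNetwork Bool Unit where
  tail _ := false
  head _ := true
  source := false
  sink := true
  demand := 1
  a _ := 2
  b _ := 0
  g _ := 0
  demand_pos := one_pos
  a_pos _ := two_pos
  b_nonneg _ := le_rfl
  g_nonneg _ := le_rfl

theorem isEquilibriumOn_singleEdge {u : ℝ} (hu : 0 ≤ u) (price : ℝ) :
    singleEdge.IsEquilibriumOn Set.univ price ⟨u, 2 * u, fun _ => u⟩ where
  mem_flowCone := by
    let p : singleEdge.SimplePath := ⟨[()], by simp [IsSimplePath, IsWalk, singleEdge]⟩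
    convert! smul_mem_flowCone hu (pathVector_mem_flowCone p) using 1
    ext <;> simp [pathVector, p]
  flow_eq_zero e he := (he (Set.mem_univ e)).elim
  exists_potential :=
    ⟨fun v => cond v (2 * u) 0, by simp [singleEdge], by simp [singleEdge, edgeCost],
      by simp [singleEdge, edgeCost]⟩

theorem isStep_singleEdge :
    singleEdge.IsStep () ⟨0, 2 * 0, fun _ => 0⟩ ⟨1, 2 * 1, fun _ => 1⟩ where
  value_nonneg := le_rfl
  cost_nonneg := by norm_num
  value_lt := one_pos
  cost_add_one_lt := by norm_num
  value_le := by simp [singleEdge]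
  cost_le := by simp [singleEdge]
  flow_eq := .inl ⟨rfl, rfl⟩
  exists_isEquilibriumOn := ⟨Set.univ, fun price =>
    ⟨isEquilibriumOn_singleEdge le_rfl price, isEquilibriumOn_singleEdge zero_le_one price⟩⟩

theorem exists_equilibriumCurve (n : ℕ) :
    ∃ (V E : Type) (_ : Fintype V) (_ : Fintype E) (N : AffineNetwork V E) (c : E),
      Fintype.card V = 2 * n + 2 ∧ Fintype.card E = 4 * n + 1 ∧ N.source ≠ N.sink ∧
      ∃ p : N.EquilibriumCurve c, p.length = 2 ^ n := by
  induction n with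
  | zero =>
    let p := (RelSeries.singleton (singleEdge.stepRel ()) _).snoc _ isStep_singleEdge
    exact ⟨Bool, Unit, _, _, singleEdge, (), rfl, rfl, Bool.false_ne_true, ⟨p, by simp [p],
      by simp [p], by simp [p, singleEdge], by simp [p, singleEdge]⟩, by simp [p]⟩
  | succ n ih =>
    obtain ⟨V, E, _, _, N, c, hV, hE, -, p, hp⟩ := ih
    refine ⟨V ⊕ Bool, E ⊕ BraessArc, inferInstance, inferInstance, N.braess, .inl c, ?_, ?_,
      by simp [braess], p.braess, ?_⟩
    · rw [Fintype.card_sum, hV, Fintype.card_bool]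
      ring
    · rw [Fintype.card_sum, hE, show Fintype.card BraessArc = 4 from rfl]
      ring
    · change p.length + p.length = 2 ^ (n + 1)
      rw [hp, pow_succ, mul_two]

end Curve

section PricedEdge

/-- The network `N` with an additional edge from the source to the sink that costs the price. It
takes over the part of the demand that the rest of the network does not serve, and thereby turns a
rise of the price into a rise of the demand of `N`. -/
def withPricedEdge (N : AffineNetwork V E) : AffineNetwork V (Option E) where
  tail e := e.elim N.source N.tail
  head e := e.elim N.sink N.head
  source := N.source
  sink := N.sink
  demand := N.demand
  a e := e.elim (1 / N.demand) N.a
  b e := e.elim 0 N.b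
  g e := e.elim 1 N.g
  demand_pos := N.demand_pos
  a_pos := by rintro (_ | e) <;> simp [N.a_pos, N.demand_pos]
  b_nonneg := by rintro (_ | e) <;> simp [N.b_nonneg]
  g_nonneg := by rintro (_ | e) <;> simp [N.g_nonneg]

/-- A path in `N`, as a path in `N.withPricedEdge`. -/
def SimplePath.withPricedEdge (p : N.SimplePath) : N.withPricedEdge.SimplePath :=
  ⟨p.1.map some, p.2.1.map (N' := N.withPricedEdge) (φ := id) (ψ := some) (fun _ => rfl)
    fun _ => rfl, by
    rw [List.map_map]
    exact p.2.2⟩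

/-- The path in `N.withPricedEdge` along the additional edge. -/
def pricedPath (hN : N.source ≠ N.sink) : N.withPricedEdge.SimplePath :=
  ⟨[none], by simpa [IsSimplePath, IsWalk, withPricedEdge] using hN⟩

theorem mem_flowCone_withPricedEdge (hN : N.source ≠ N.sink) {u r : ℝ} {y : E → ℝ}
    (h : (u, y) ∈ N.flowCone) (hr : 0 ≤ r) :
    (u + r, fun e : Option E => e.elim r y) ∈ N.withPricedEdge.flowCone := by
  classical
  let L : ℝ × (E → ℝ) →ₗ[ℝ≥0] ℝ × (Option E → ℝ) :=
    { toFun := fun x => (x.1, fun e => e.elim 0 x.2)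
      map_add' := fun x x' => by ext (_ | _) <;> simp
      map_smul' := fun a x => by ext (_ | _) <;> simp }
  have hL : L (u, y) ∈ N.withPricedEdge.flowCone := by
    refine map_mem_flowCone (fun p => ?_) h
    convert! pathVector_mem_flowCone p.withPricedEdge using 1
    ext (_ | _) <;> simp [L, pathVector, SimplePath.withPricedEdge, Set.indicator_apply]
  convert! N.withPricedEdge.flowCone.add_mem hL
    (smul_mem_flowCone hr (pathVector_mem_flowCone (pricedPath hN))) using 1
  ext (_ | _) <;> simp [L, pathVector, pricedPath]

/-- The price at which an additional edge that serves the rest of the demand `d` costs as much as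
the cheapest paths. -/
noncomputable def FlowState.price (d : ℝ) (s : FlowState E) : ℝ :=
  s.cost - (d - s.value) / d

/-- The state `s` of a network, supplemented by an additional edge that serves the rest of the
demand `d`. -/
noncomputable def FlowState.priced (d : ℝ) (s : FlowState E) : FlowState (Option E) :=
  ⟨d, s.cost, fun e => e.elim (d - s.value) s.flow⟩

theorem IsEquilibriumOn.withPricedEdge (hN : N.source ≠ N.sink) {T : Set E} {price : ℝ}
    {s : FlowState E} (hs : N.IsEquilibriumOn T price s) (hvalue : s.value ≤ N.demand)
    (hprice : s.price N.demand ≤ price) {used : Prop} (htight : used → s.price N.demand = price)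
    (hidle : ¬used → s.value = N.demand) :
    N.withPricedEdge.IsEquilibriumOn {e | e.elim used (· ∈ T)} price (s.priced N.demand) where
  mem_flowCone := by
    simpa [FlowState.priced] using
      mem_flowCone_withPricedEdge hN hs.mem_flowCone (sub_nonneg.2 hvalue)
  flow_eq_zero := by
    rintro (_ | e) he
    · exact sub_eq_zero.2 (hidle he).symm
    · exact hs.flow_eq_zero e he
  exists_potential := by
    obtain ⟨π, hπ, hle, heq⟩ := hs.exists_potential
    have hcost : N.withPricedEdge.edgeCost price none ((s.priced N.demand).flow none) =
        s.cost + (price - s.price N.demand) := by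
      simp [edgeCost, AffineNetwork.withPricedEdge, FlowState.priced, FlowState.price]
      ring
    refine ⟨π, hπ, ?_, ?_⟩
    · rintro (_ | e)
      · rw [hcost]
        exact hπ.trans_le (by linarith)
      · exact hle e
    · rintro (_ | e) he
      · rw [hcost, htight he, sub_self, add_zero]
        exact hπ
      · exact heq e he

variable {c : E} {s s' : FlowState E}

theorem IsStep.price_lt_price (h : N.IsStep c s s') : s.price N.demand < s'.price N.demand := by
  have hd : (0 : ℝ) < N.demand := by exact_mod_cast N.demand_pos
  have hdiv : (N.demand - s'.value) / N.demand < (N.demand - s.value) / (N.demand : ℝ) :=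
    div_lt_div_of_pos_right (sub_lt_sub_left h.value_lt _) hd
  simp only [FlowState.price]
  linarith [h.cost_add_one_lt]

theorem IsStep.price_pos (h : N.IsStep c s s') : 0 < s'.price N.demand := by
  have hd : (0 : ℝ) < N.demand := by exact_mod_cast N.demand_pos
  have hdiv : (N.demand - s'.value) / (N.demand : ℝ) ≤ 1 :=
    div_le_one_of_le₀ (by linarith [h.value_nonneg, h.value_lt]) hd.le
  simp only [FlowState.price]
  linarith [h.cost_add_one_lt, h.cost_nonneg]

namespace EquilibriumCurve

variable (p : N.EquilibriumCurve c)

/-- The price at which the equilibrium of the network with the additional priced edge is the `i`-th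
knot of the curve. -/
noncomputable def knotPrice (i : Fin (p.length + 1)) : ℝ :=
  (p.toRelSeries i).price N.demand

theorem strictMono_knotPrice : StrictMono p.knotPrice :=
  Fin.strictMono_iff_lt_succ.2 fun i => (p.step i).price_lt_price

theorem last_ne_zero : Fin.last p.length ≠ 0 := by
  intro h
  have hvalue : p.last.value = p.head.value := congrArg (fun i => (p.toRelSeries i).value) h
  rw [p.value_last, p.value_head] at hvalue
  exact N.demand_pos.ne' (by exact_mod_cast hvalue)

theorem knotPrice_zero : p.knotPrice 0 = -1 := by
  have hd : (N.demand : ℝ) ≠ 0 := by exact_mod_cast N.demand_pos.ne'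
  have hhead : p.toRelSeries 0 = p.head := rfl
  simp [knotPrice, hhead, FlowState.price, p.value_head, p.cost_head, hd]

end EquilibriumCurve

end PricedEdge

section Breakpoints

variable [Fintype V] [Fintype E] {c : E} {s s' : FlowState E}

theorem IsStep.isWardropEdgeFlow (h : N.IsStep c s s') (hN : N.source ≠ N.sink) {t : ℝ}
    (ht : t ∈ Set.Icc (s.price N.demand) (s'.price N.demand)) :
    N.withPricedEdge.IsWardropEdgeFlow t ((s.priced N.demand).flow +
      (t - s.price N.demand) • (s'.price N.demand - s.price N.demand)⁻¹ •
        ((s'.priced N.demand).flow - (s.priced N.demand).flow)) := by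
  obtain ⟨T, hT⟩ := h.exists_isEquilibriumOn
  have hvalue : s.value ≤ N.demand := h.value_lt.le.trans h.value_le
  exact ((hT _).1.withPricedEdge hN (used := True) hvalue le_rfl (fun _ => rfl)
    fun h => (h trivial).elim).isWardropEdgeFlow_of_mem_Icc
      ((hT _).2.withPricedEdge hN h.value_le le_rfl (fun _ => rfl) fun h => (h trivial).elim)
      rfl rfl h.price_lt_price ht

/-- The edge loads in a Wardrop equilibrium at the given price; a junk value if there is none. -/
noncomputable def equilibriumFlow (N : AffineNetwork V E) (price : ℝ) : E → ℝ :=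
  Classical.epsilon (N.IsWardropEdgeFlow price)

theorem isWardropEdgeFlow_equilibriumFlow {price : ℝ} (h : ∃ y, N.IsWardropEdgeFlow price y) :
    N.IsWardropEdgeFlow price (N.equilibriumFlow price) :=
  Classical.epsilon_spec h

theorem IsWardropEdgeFlow.equilibriumFlow_eq {price : ℝ} {y : E → ℝ}
    (h : N.IsWardropEdgeFlow price y) : N.equilibriumFlow price = y :=
  (isWardropEdgeFlow_equilibriumFlow ⟨y, h⟩).unique h

theorem IsStep.isSwing (h : N.IsStep c s s') (hN : N.source ≠ N.sink) :
    IsSwing N.withPricedEdge.equilibriumFlow (some c) (s.price N.demand)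
      (s'.price N.demand) := by
  have hlt := h.price_lt_price
  have hflow (t) (ht : t ∈ Set.Icc (s.price N.demand) (s'.price N.demand)) :=
    (h.isWardropEdgeFlow hN ht).equilibriumFlow_eq
  have hleft : N.withPricedEdge.equilibriumFlow (s.price N.demand) = (s.priced N.demand).flow := by
    rw [hflow _ ⟨le_rfl, hlt.le⟩]
    module
  have hright : N.withPricedEdge.equilibriumFlow (s'.price N.demand) =
      (s'.priced N.demand).flow := by
    rw [hflow _ ⟨hlt.le, le_rfl⟩, smul_inv_smul₀ (sub_pos.2 hlt).ne', add_sub_cancel]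
  refine ⟨hlt, fun t ht => ?_, ?_⟩
  · rw [slope_def_module, hleft, hright, hflow t ht]
  · rw [hleft, hright]
    exact h.flow_eq

namespace EquilibriumCurve

variable (p : N.EquilibriumCurve c)

theorem isWardropEdgeFlow_last (hN : N.source ≠ N.sink) {t : ℝ}
    (ht : p.knotPrice (Fin.last _) ≤ t) :
    N.withPricedEdge.IsWardropEdgeFlow t (p.last.priced N.demand).flow := by
  obtain ⟨j, hj⟩ := Fin.exists_succ_eq.2 p.last_ne_zero
  obtain ⟨T, hT⟩ := (p.step j).exists_isEquilibriumOn
  rw [hj] at hT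
  exact ((hT t).2.withPricedEdge hN (used := False) p.value_last.le ht False.elim
    fun _ => p.value_last).isWardropEdgeFlow rfl

theorem exists_isWardropEdgeFlow (hN : N.source ≠ N.sink) {t : ℝ} (ht : p.knotPrice 0 ≤ t) :
    ∃ y, N.withPricedEdge.IsWardropEdgeFlow t y := by
  rcases le_or_gt (p.knotPrice (Fin.last _)) t with hlast | hlast
  · exact ⟨_, p.isWardropEdgeFlow_last hN hlast⟩
  obtain ⟨i, hi, hi'⟩ :
      ∃ i : Fin p.length, p.knotPrice i.castSucc ≤ t ∧ t < p.knotPrice i.succ := by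
    by_contra! hnext
    exact hlast.not_ge (Fin.induction (motive := fun i => p.knotPrice i ≤ t) ht hnext (Fin.last _))
  exact ⟨_, (p.step i).isWardropEdgeFlow hN ⟨hi, hi'.le⟩⟩

theorem knotPrice_pos_and_isBreakpoint {i : Fin (p.length + 1)}
    (hi : i ∈ Set.Ioo 0 (Fin.last p.length)) (hN : N.source ≠ N.sink) :
    0 < p.knotPrice i ∧ IsBreakpoint N.withPricedEdge.equilibriumFlow (p.knotPrice i) := by
  obtain ⟨j, hj⟩ := Fin.exists_succ_eq.2 hi.1.ne'
  obtain ⟨k, hk⟩ := Fin.exists_castSucc_eq.2 hi.2.ne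
  have hbefore := p.step j
  have hafter := p.step k
  rw [hj] at hbefore
  rw [hk] at hafter
  exact ⟨hbefore.price_pos, (hbefore.isSwing hN).isBreakpoint (hafter.isSwing hN)⟩

theorem length_sub_one_le_encard (hN : N.source ≠ N.sink) :
    ((p.length - 1 : ℕ) : ℕ∞) ≤
      {price : ℝ | 0 < price ∧ IsBreakpoint N.withPricedEdge.equilibriumFlow price}.encard := by
  calc ((p.length - 1 : ℕ) : ℕ∞) = (Set.Ioo 0 (Fin.last p.length)).encard := by
        simp [← Finset.coe_Ioo]
    _ = (p.knotPrice '' Set.Ioo 0 (Fin.last p.length)).encard :=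
        (p.strictMono_knotPrice.injective.encard_image _).symm
    _ ≤ _ := Set.encard_le_encard <| by
        rintro _ ⟨i, hi, rfl⟩
        exact p.knotPrice_pos_and_isBreakpoint hi hN

end EquilibriumCurve

end Breakpoints
end AffineNetwork

theorem mainTheorem12 :
    ∃ C : ℕ, ∀ k : ℕ, ∃ (V E : Type) (_ : Fintype V) (_ : Fintype E) (N : AffineNetwork V E),
      Fintype.card V ≤ C * (k + 1) ∧ Fintype.card E ≤ C * (k + 1) ∧
      ∃ x : ℝ → E → ℝ,
        (∀ price : ℝ, 0 < price → ∀ y : E → ℝ, N.IsWardropEdgeFlow price y ↔ y = x price) ∧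
        2 ^ (k + 1) ≤ {price : ℝ | 0 < price ∧ IsBreakpoint x price}.encard := by
  refine ⟨10, fun k => ?_⟩
  obtain ⟨V, E, _, _, N, c, hV, hE, hN, p, hp⟩ :=
    AffineNetwork.exists_equilibriumCurve (k + 2)
  refine ⟨V, Option E, inferInstance, inferInstance, N.withPricedEdge, by lia, ?_,
    N.withPricedEdge.equilibriumFlow,
    fun price hprice y => ⟨fun h => h.equilibriumFlow_eq.symm, ?_⟩, ?_⟩
  · rw [Fintype.card_option, hE]
    lia
  · rintro rfl
    have hknot : p.knotPrice 0 ≤ price := by linarith [p.knotPrice_zero]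
    exact AffineNetwork.isWardropEdgeFlow_equilibriumFlow (p.exists_isWardropEdgeFlow hN hknot)
  · have hpow : 2 ^ (k + 1) ≤ p.length - 1 := by
      rw [hp, pow_succ 2 (k + 1)]
      have hone := Nat.one_le_two_pow (n := k + 1)
      lia
    exact le_trans (by exact_mod_cast hpow) (p.length_sub_one_le_encard hN)
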